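/- Let $(W,S)$ be a Coxeter system with $W$ finite and simply-laced, i.e. the order $m(s,s')$ of $ss'$ is $2$ or $3$ for all distinct $s,s'\in S$ (equivalently, $W$ is a finite Weyl group of simply-laced type, not necessarily irreducible). Let $\ell$ denote the length function and $T=\{wsw^{-1}: w\in W, s\in S\}$ the set of reflections. Let $\le$ be the (strong) Bruhat order on $W$, i.e. the reflexive and transitive closure of the relations $w\to wt$ for $w\in W$, $t\in T$ with $\ell(wt)>\ell(w)$, and write $a\lessdot b$ if $b$ covers $a$ in this order. Suppose that $x_1\neq x_2$ and $y_1\neq y_2$ are elements of $W$ forming a butterfly, i.e. $x_1\lessdot y_1$, $x_1\lessdot y_2$, $x_2\lessdot y_1$ and $x_2\lessdot y_2$. Then there exist $u\in W$ with $u\lessdot x_1$ and $u\lessdot x_2$, and $z\in W$ with $y_1\lessdot z$ and $y_2\lessdot z$. -/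

import Mathlib

namespace CoxeterMatrix

/-- A Coxeter matrix is simply-laced if every off-diagonal entry is `2` or `3` (in particular no
entry is `0`, which encodes `∞`). -/
def IsSimplyLaced {B : Type*} (M : CoxeterMatrix B) : Prop :=
  ∀ i j : B, i ≠ j → M i j = 2 ∨ M i j = 3

end CoxeterMatrix

namespace CoxeterSystem

/-- The edges `u → u t` of the directed Bruhat graph: `t` is a reflection, `ℓ(u t) > ℓ(u)`. -/
def BruhatEdge {B W : Type*} [Group W] {M : CoxeterMatrix B} (cs : CoxeterSystem M W)
    (u v : W) : Prop :=
  ∃ t : W, cs.IsReflection t ∧ v = u * t ∧ cs.length u < cs.length v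

theorem length_le_of_reflTransGen_bruhatEdge {B W : Type*} [Group W] {M : CoxeterMatrix B}
    (cs : CoxeterSystem M W) {u v : W} (h : Relation.ReflTransGen cs.BruhatEdge u v) :
    u = v ∨ cs.length u < cs.length v := by
  induction h with
  | refl => exact Or.inl rfl
  | tail _ hbc ih =>
    obtain ⟨t, -, -, hlt⟩ := hbc
    rcases ih with rfl | ih
    · exact Or.inr hlt
    · exact Or.inr (ih.trans hlt)

/-- The (strong) Bruhat order on a Coxeter group: the reflexive and transitive closure of the
directed Bruhat graph. -/
@[reducible] def bruhatOrder {B W : Type*} [Group W] {M : CoxeterMatrix B}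
    (cs : CoxeterSystem M W) : PartialOrder W where
  le u v := Relation.ReflTransGen cs.BruhatEdge u v
  le_refl _ := Relation.ReflTransGen.refl
  le_trans _ _ _ h₁ h₂ := h₁.trans h₂
  le_antisymm u v h₁ h₂ := by
    rcases cs.length_le_of_reflTransGen_bruhatEdge h₁ with h | h
    · exact h
    · rcases cs.length_le_of_reflTransGen_bruhatEdge h₂ with h' | h'
      · exact h'.symm
      · exact absurd h (lt_asymm h')

/-- The cover relation `u ⋖ v` of the Bruhat order. -/
def BruhatCovBy {B W : Type*} [Group W] {M : CoxeterMatrix B} (cs : CoxeterSystem M W)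
    (u v : W) : Prop :=
  letI : PartialOrder W := cs.bruhatOrder
  u ⋖ v

/-- Two distinct elements `x₁, x₂` and two distinct elements `y₁, y₂` of a Coxeter group form a
butterfly if, in Bruhat order, both of `y₁, y₂` cover both of `x₁, x₂`. -/
structure IsButterfly {B W : Type*} [Group W] {M : CoxeterMatrix B} (cs : CoxeterSystem M W)
    (x₁ x₂ y₁ y₂ : W) : Prop where
  ne_bot : x₁ ≠ x₂
  ne_top : y₁ ≠ y₂
  cov₁₁ : cs.BruhatCovBy x₁ y₁
  cov₁₂ : cs.BruhatCovBy x₁ y₂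
  cov₂₁ : cs.BruhatCovBy x₂ y₁
  cov₂₂ : cs.BruhatCovBy x₂ y₂

end CoxeterSystem

/-!
The group `W` acts on its root lattice `B →₀ ℤ`. A reflection `s_b` is given by a positive root `b`,
length counts the positive roots made negative (`length_eq_ncard_rootInversions`), and finiteness
bounds the pairing of distinct positive roots by `1` in absolute value (`IsRoot.form_bounds`).

Suppose that `x` keeps the positive root `b` positive. Then `x s_b` covers `x` in Bruhat order if
and only if `b` is not the sum of two positive roots that `x` keeps positive (`NoPositiveSplit`,
`BruhatCovBy.exists_isRootReflection`, `bruhatCovBy_of_noPositiveSplit`).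

In a butterfly write `y₁ = x₁ s_a = x₂ s_b` and `y₂ = x₁ s_c = x₂ s_d`. Then
`s_a s_b = s_c s_d ≠ 1`, so that `a`, `b`, `c`, `d` lie in one plane, and a simply-laced root system
of rank two has type `A₁ × A₁` or `A₂`. Comparing signs leaves only one picture: there is `x` that
keeps the simple roots `α`, `β` of a subsystem of type `A₂` positive, with
`{x₁, x₂} = {x s_α, x s_β}` and `{y₁, y₂} = {x s_α s_β, x s_β s_α}`
(`IsRootReflection.eq_or_eq_of_mul_eq_mul`, `exists_bruhatCovBy_of_mul_eq_mul`). The elements sought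
are `u = x` and `z = x s_α s_β s_α`. They give covers because a splitting of `α` or `β` would yield
a splitting of `α + β` that contradicts one of the diagonal covers `x₁ ⋖ y₂`, `x₂ ⋖ y₁`
(`noPositiveSplit_of_add`, `bruhatCovBy_hexagon`).
-/

/-! ### The geometric representation over the integers -/

namespace CoxeterMatrix

variable {B : Type*} (M : CoxeterMatrix B)

open scoped Classical in
/-- The bilinear form on the root lattice `B →₀ ℤ` of a simply-laced Coxeter matrix: simple roots
have norm `2`, and distinct simple roots pair to `-1` if they are joined by an edge of the Dynkin
diagram and to `0` otherwise. -/
noncomputable def cartanForm : (B →₀ ℤ) →ₗ[ℤ] (B →₀ ℤ) →ₗ[ℤ] ℤ :=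
  Finsupp.linearCombination ℤ fun i => Finsupp.linearCombination ℤ fun j =>
    if i = j then 2 else if M i j = 3 then -1 else 0

open scoped Classical in
theorem cartanForm_single (i j : B) :
    M.cartanForm (Finsupp.single i 1) (Finsupp.single j 1) =
      if i = j then 2 else if M i j = 3 then -1 else 0 := by
  simp [cartanForm]

theorem cartanForm_single_self (i : B) :
    M.cartanForm (Finsupp.single i 1) (Finsupp.single i 1) = 2 := by
  simp [cartanForm_single]

theorem cartanForm_single_of_eq_two {i j : B} (h : M i j = 2) :
    M.cartanForm (Finsupp.single i 1) (Finsupp.single j 1) = 0 := by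
  have hij : i ≠ j := fun e => by simp [e] at h
  simp [cartanForm_single, hij, h]

theorem cartanForm_single_of_eq_three {i j : B} (h : M i j = 3) :
    M.cartanForm (Finsupp.single i 1) (Finsupp.single j 1) = -1 := by
  have hij : i ≠ j := fun e => by simp [e] at h
  simp [cartanForm_single, hij, h]

theorem cartanForm_comm (u v : B →₀ ℤ) : M.cartanForm u v = M.cartanForm v u := by
  have h : M.cartanForm = M.cartanForm.flip := by
    classical
    ext i j
    simp only [LinearMap.comp_apply, Finsupp.lsingle_apply, LinearMap.flip_apply,
      cartanForm_single, M.symmetric i j, eq_comm (a := i)]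
  exact congrArg (fun f : (B →₀ ℤ) →ₗ[ℤ] (B →₀ ℤ) →ₗ[ℤ] ℤ => f u v) h

/-- The map `u ↦ u - (u, v) v`, which is the reflection in `v` if `v` has norm `2`. -/
noncomputable def formReflection (v : B →₀ ℤ) : Module.End ℤ (B →₀ ℤ) :=
  LinearMap.id - (M.cartanForm.flip v).smulRight v

theorem formReflection_apply (v u : B →₀ ℤ) :
    M.formReflection v u = u - M.cartanForm u v • v := by
  simp [formReflection]

theorem isLiftable_formReflection (hM : M.IsSimplyLaced) :
    M.IsLiftable fun i => M.formReflection (Finsupp.single i 1) := by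
  intro i j
  refine LinearMap.ext fun u => ?_
  by_cases hij : i = j
  · subst hij
    simp only [M.diagonal, pow_one, Module.End.mul_apply, formReflection_apply, map_sub, map_smul,
      cartanForm_single_self, Module.End.one_apply]
    module
  rcases hM i j hij with h | h
  · have h' : M j i = 2 := by rw [M.symmetric, h]
    simp only [h, pow_succ, pow_zero, one_mul, Module.End.mul_apply, formReflection_apply,
      map_sub, map_smul, cartanForm_single_self, M.cartanForm_single_of_eq_two h,
      M.cartanForm_single_of_eq_two h', Module.End.one_apply]
    module
  · have h' : M j i = 3 := by rw [M.symmetric, h]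
    simp only [h, pow_succ, pow_zero, one_mul, Module.End.mul_apply, formReflection_apply,
      map_sub, map_smul, cartanForm_single_self, M.cartanForm_single_of_eq_three h,
      M.cartanForm_single_of_eq_three h', Module.End.one_apply]
    module

end CoxeterMatrix

namespace CoxeterSystem

variable {B W : Type*} [Group W] {M : CoxeterMatrix B} (cs : CoxeterSystem M W)
  (hM : M.IsSimplyLaced)

/-- The geometric representation of a simply-laced Coxeter group on its root lattice `B →₀ ℤ`, in
which the simple reflection `s i` acts as the reflection in the basis vector at `i`. -/
noncomputable def rootRep : W →* Module.End ℤ (B →₀ ℤ) :=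
  cs.lift ⟨_, M.isLiftable_formReflection hM⟩

theorem rootRep_simple_apply (i : B) (v : B →₀ ℤ) :
    cs.rootRep hM (cs.simple i) v =
      v - M.cartanForm v (Finsupp.single i 1) • Finsupp.single i 1 := by
  rw [rootRep, lift_apply_simple, M.formReflection_apply]

theorem rootRep_mul_apply (w w' : W) (v : B →₀ ℤ) :
    cs.rootRep hM (w * w') v = cs.rootRep hM w (cs.rootRep hM w' v) := by
  rw [map_mul, Module.End.mul_apply]

theorem rootRep_apply_inv_self (w : W) (v : B →₀ ℤ) :
    cs.rootRep hM w (cs.rootRep hM w⁻¹ v) = v := by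
  rw [← rootRep_mul_apply, mul_inv_cancel, map_one, Module.End.one_apply]

theorem cartanForm_rootRep (w : W) (u v : B →₀ ℤ) :
    M.cartanForm (cs.rootRep hM w u) (cs.rootRep hM w v) = M.cartanForm u v := by
  induction w using cs.simple_induction_left with
  | one => simp
  | mul_simple_left w i ih =>
    rw [← ih, rootRep_mul_apply, rootRep_mul_apply, rootRep_simple_apply, rootRep_simple_apply]
    simp only [map_sub, map_smul, LinearMap.sub_apply, LinearMap.smul_apply,
      M.cartanForm_single_self, M.cartanForm_comm (Finsupp.single i 1), smul_eq_mul]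
    ring

/-! ### Roots and reflections -/

/-- A root is a vector in the orbit of a simple root. A positive root is a root `v` with `0 ≤ v` in
the coordinatewise order of `B →₀ ℤ`. -/
def IsRoot (v : B →₀ ℤ) : Prop := ∃ w i, v = cs.rootRep hM w (Finsupp.single i 1)

/-- The element `t` of `W` is the reflection in the root `b`: it is a reflection of the Coxeter
system and acts on the root lattice by `v ↦ v - (v, b) b`. -/
structure IsRootReflection (b : B →₀ ℤ) (t : W) : Prop where
  isRoot : cs.IsRoot hM b
  isReflection : cs.IsReflection t
  apply_eq : ∀ v, cs.rootRep hM t v = v - M.cartanForm v b • b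

variable {cs hM} {b γ δ : B →₀ ℤ} {t u : W}

theorem isRoot_simple (i : B) : cs.IsRoot hM (Finsupp.single i 1) := ⟨1, i, by simp⟩

theorem IsRoot.rootRep (hb : cs.IsRoot hM b) (w : W) : cs.IsRoot hM (cs.rootRep hM w b) := by
  obtain ⟨w', i, rfl⟩ := hb
  exact ⟨w * w', i, (cs.rootRep_mul_apply hM _ _ _).symm⟩

theorem IsRoot.form_self (hb : cs.IsRoot hM b) : M.cartanForm b b = 2 := by
  obtain ⟨w, i, rfl⟩ := hb
  rw [cartanForm_rootRep, M.cartanForm_single_self]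

theorem isRootReflection_simple (i : B) :
    cs.IsRootReflection hM (Finsupp.single i 1) (cs.simple i) :=
  ⟨isRoot_simple i, cs.isReflection_simple i, cs.rootRep_simple_apply hM i⟩

theorem IsRootReflection.conj (h : cs.IsRootReflection hM b t) (w : W) :
    cs.IsRootReflection hM (cs.rootRep hM w b) (w * t * w⁻¹) := by
  refine ⟨h.isRoot.rootRep w, h.isReflection.conj w, fun v => ?_⟩
  conv_rhs => rw [← cs.rootRep_apply_inv_self hM w v, cartanForm_rootRep]
  rw [rootRep_mul_apply, rootRep_mul_apply, h.apply_eq, map_sub, map_smul]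

theorem IsRoot.exists_isRootReflection (hb : cs.IsRoot hM b) :
    ∃ t, cs.IsRootReflection hM b t := by
  obtain ⟨w, i, rfl⟩ := hb
  exact ⟨_, (isRootReflection_simple i).conj w⟩

theorem IsRootReflection.apply_self (h : cs.IsRootReflection hM b t) :
    cs.rootRep hM t b = -b := by
  rw [h.apply_eq, h.isRoot.form_self]
  module

theorem IsRootReflection.mul_self (h : cs.IsRootReflection hM b t) : t * t = 1 :=
  h.isReflection.mul_self

theorem IsRootReflection.apply_apply (h : cs.IsRootReflection hM b t) (v : B →₀ ℤ) :
    cs.rootRep hM t (cs.rootRep hM t v) = v := by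
  rw [← rootRep_mul_apply, h.mul_self, map_one, Module.End.one_apply]

theorem IsRoot.neg (hb : cs.IsRoot hM b) : cs.IsRoot hM (-b) := by
  obtain ⟨t, ht⟩ := hb.exists_isRootReflection
  exact ht.apply_self ▸ hb.rootRep t

theorem IsRootReflection.neg (h : cs.IsRootReflection hM b t) : cs.IsRootReflection hM (-b) t :=
  ⟨h.isRoot.neg, h.isReflection, fun v => by rw [h.apply_eq]; simp⟩

theorem IsReflection.exists_isRootReflection (ht : cs.IsReflection t) :
    ∃ b, cs.IsRootReflection hM b t := by
  obtain ⟨w, i, rfl⟩ := ht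
  exact ⟨_, (isRootReflection_simple i).conj w⟩

variable (cs hM) in
/-- If `s i` is not a right descent of `w`, then `w` sends the simple root at `i` to a nonnegative
vector. The induction removes from `w` a right factor in the dihedral group generated by `s i` and
another right descent `s j`; being simply-laced leaves just two shapes for this group. -/
theorem rootRep_single_nonneg (w : W) (i : B) (h : cs.length w < cs.length (w * cs.simple i)) :
    0 ≤ cs.rootRep hM w (Finsupp.single i 1) := by
  induction hn : cs.length w using Nat.strong_induction_on generalizing w i with
  | _ n ih =>
  subst hn
  by_cases hw : w = 1
  · simp [hw]
  obtain ⟨j, hj⟩ := cs.exists_rightDescent_of_ne_one hw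
  have hij : i ≠ j := fun e => lt_asymm h (e ▸ hj)
  unfold IsRightDescent at hj
  have hw' : w = w * cs.simple j * cs.simple j := by simp
  have hrep (v) : cs.rootRep hM w v =
      cs.rootRep hM (w * cs.simple j) (cs.rootRep hM (cs.simple j) v) := by
    rw [← rootRep_mul_apply, ← hw']
  have hjs := cs.length_mul_simple w j
  have his := cs.length_mul_simple w i
  rcases hM i j hij with hm | hm
  · have hcomm : cs.simple i * cs.simple j = cs.simple j * cs.simple i := by
      have := cs.simple_mul_simple_pow i j
      rw [hm, pow_two, mul_eq_one_iff_eq_inv] at this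
      simpa using this
    rw [hrep, rootRep_simple_apply, M.cartanForm_single_of_eq_two hm, zero_smul, sub_zero]
    refine ih _ hj _ _ ?_ rfl
    rw [mul_assoc, ← hcomm, ← mul_assoc]
    have := cs.length_mul_simple (w * cs.simple i) j
    omega
  · have hm' : M j i = 3 := by rw [M.symmetric, hm]
    have hbraid : cs.simple i * cs.simple j * cs.simple i =
        cs.simple j * cs.simple i * cs.simple j := by
      have := cs.simple_mul_simple_pow i j
      rw [hm, show (3 : ℕ) = 2 + 1 from rfl, pow_succ, pow_two, ← mul_assoc, mul_assoc _ (_ * _),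
        mul_assoc, mul_eq_one_iff_eq_inv] at this
      simpa [mul_assoc] using congrArg (· * cs.simple i) this
    rw [hrep, rootRep_simple_apply, M.cartanForm_single_of_eq_three hm, neg_one_smul,
      sub_neg_eq_add, map_add]
    have hj' : 0 ≤ cs.rootRep hM (w * cs.simple j) (Finsupp.single j 1) :=
      ih _ hj _ _ (by rwa [← hw']) rfl
    rcases cs.length_mul_simple (w * cs.simple j) i with h1 | h1
    · exact add_nonneg (ih _ hj _ _ (by omega) rfl) hj'
    · have hw2 : w * cs.simple j = w * cs.simple j * cs.simple i * cs.simple i := by simp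
      rw [← map_add, hw2, rootRep_mul_apply, map_add, rootRep_simple_apply, rootRep_simple_apply,
        M.cartanForm_single_self, M.cartanForm_single_of_eq_three hm']
      have hlen : cs.length (w * cs.simple j * cs.simple i) <
          cs.length (w * cs.simple j * cs.simple i * cs.simple j) := by
        have h0 : w * cs.simple j * cs.simple i * cs.simple j =
            w * cs.simple i * cs.simple j * cs.simple i := by
          simpa only [mul_assoc] using congrArg (w * ·) hbraid.symm
        rw [h0]
        have h2 := cs.length_mul_simple (w * cs.simple i) j
        have h3 := cs.length_mul_simple (w * cs.simple i * cs.simple j) i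
        omega
      have := ih _ (by omega) _ _ hlen rfl
      convert this using 2
      module

theorem IsRoot.nonneg_or_neg_nonneg (hb : cs.IsRoot hM b) : 0 ≤ b ∨ 0 ≤ -b := by
  obtain ⟨w, i, rfl⟩ := hb
  rcases cs.length_mul_simple w i with h | h
  · exact Or.inl (cs.rootRep_single_nonneg hM w i (by omega))
  · have := cs.rootRep_single_nonneg hM (w * cs.simple i) i (by simp; omega)
    rw [rootRep_mul_apply, (isRootReflection_simple i).apply_self, map_neg] at this
    exact Or.inr this

theorem IsRoot.neg_nonneg_iff (hb : cs.IsRoot hM b) : 0 ≤ -b ↔ ¬ 0 ≤ b := by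
  refine ⟨fun h h' => ?_, fun h => hb.nonneg_or_neg_nonneg.resolve_left h⟩
  have h0 : b = 0 := le_antisymm (neg_nonneg.mp h) h'
  have := hb.form_self
  simp [h0] at this

theorem IsReflection.exists_nonneg_isRootReflection
    (ht : cs.IsReflection t) : ∃ b, 0 ≤ b ∧ cs.IsRootReflection hM b t := by
  obtain ⟨b, hb⟩ := ht.exists_isRootReflection (hM := hM)
  rcases hb.isRoot.nonneg_or_neg_nonneg with h | h
  exacts [⟨b, h, hb⟩, ⟨-b, h, hb.neg⟩]

end CoxeterSystem

namespace CoxeterSystem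

variable {B W : Type*} [Group W] {M : CoxeterMatrix B} {cs : CoxeterSystem M W}
  {hM : M.IsSimplyLaced} {a b c d γ δ : B →₀ ℤ} {t u w x : W}

/-! ### Bounds from finiteness -/

theorem simple_injective_of_isSimplyLaced (cs : CoxeterSystem M W) (hM : M.IsSimplyLaced) :
    Function.Injective cs.simple := by
  intro i j h
  by_contra hij
  have h1 := (isRootReflection_simple (cs := cs) (hM := hM) i).apply_self
  rw [h, rootRep_simple_apply] at h1
  have h2 := DFunLike.congr_fun h1 i
  simp [Ne.symm hij] at h2

theorem finite_setOf_isRoot [Finite W] : {v | cs.IsRoot hM v}.Finite := by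
  have : Finite B := Finite.of_injective _ (cs.simple_injective_of_isSimplyLaced hM)
  refine (Set.finite_range fun p : W × B => cs.rootRep hM p.1 (Finsupp.single p.2 1)).subset ?_
  rintro v ⟨w, i, rfl⟩
  exact ⟨(w, i), rfl⟩

variable (cs hM) in
/-- The average over the finite group `W` of the standard quadratic form provides a `W`-invariant
positive definite form. -/
theorem exists_invariant_form [Finite W] : ∃ f : (B →₀ ℤ) →ₗ[ℤ] (B →₀ ℤ) →ₗ[ℤ] ℤ,
    (∀ u v, f u v = f v u) ∧ (∀ v, v ≠ 0 → 0 < f v v) ∧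
      ∀ w u v, f (cs.rootRep hM w u) (cs.rootRep hM w v) = f u v := by
  classical
  have := Fintype.ofFinite W
  let dot : (B →₀ ℤ) →ₗ[ℤ] (B →₀ ℤ) →ₗ[ℤ] ℤ :=
    Finsupp.linearCombination ℤ fun i => Finsupp.lapply i
  have dot_apply (u v) : dot u v = u.sum fun i a => a * v i := by
    simp [dot, Finsupp.linearCombination_apply, Finsupp.sum, LinearMap.sum_apply]
  have dot_comm (u v) : dot u v = dot v u := by
    have h : dot = dot.flip := by
      ext i j
      simp [dot, Finsupp.single_apply, eq_comm]
    exact congrArg (fun f : (B →₀ ℤ) →ₗ[ℤ] (B →₀ ℤ) →ₗ[ℤ] ℤ => f u v) h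
  have dot_nonneg (v) : 0 ≤ dot v v := by
    rw [dot_apply]
    exact Finset.sum_nonneg fun i _ => mul_self_nonneg _
  have dot_pos (v) (hv : v ≠ 0) : 0 < dot v v := by
    rw [dot_apply]
    refine Finset.sum_pos (fun i hi => ?_) (by simpa [Finset.nonempty_iff_ne_empty] using hv)
    exact mul_self_pos.mpr (by simpa using hi)
  let f : (B →₀ ℤ) →ₗ[ℤ] (B →₀ ℤ) →ₗ[ℤ] ℤ :=
    ∑ g : W, dot.compl₁₂ (cs.rootRep hM g) (cs.rootRep hM g)
  have f_apply (u v) : f u v = ∑ g : W, dot (cs.rootRep hM g u) (cs.rootRep hM g v) := by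
    simp [f, LinearMap.sum_apply]
  refine ⟨f, fun u v => ?_, fun v hv => ?_, fun w u v => ?_⟩
  · simp only [f_apply, dot_comm (cs.rootRep hM _ u)]
  · rw [f_apply]
    refine Finset.sum_pos' (fun g _ => dot_nonneg _) ⟨1, Finset.mem_univ _, ?_⟩
    simpa using dot_pos v hv
  · simp only [f_apply, ← rootRep_mul_apply]
    exact Fintype.sum_equiv (Equiv.mulRight w) _ _ fun g => rfl

/-- Two roots of a finite simply-laced Coxeter group pair to at most `2`, with equality only for
equal roots: if the pairing is nonzero, then the roots have the same length in an invariant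
positive definite form, and the claim is the Cauchy–Schwarz inequality for that form. -/
theorem IsRoot.form_le_two [Finite W] (ha : cs.IsRoot hM a) (hb : cs.IsRoot hM b) :
    M.cartanForm a b ≤ 2 ∧ (M.cartanForm a b = 2 → a = b) := by
  obtain ⟨f, hsymm, hpos, hinv⟩ := exists_invariant_form cs hM
  -- Reflections preserve `f`, so they are given by the usual formula in terms of `f`.
  have key {v b} (hb : cs.IsRoot hM b) : M.cartanForm v b * f b b = 2 * f v b := by
    obtain ⟨t, ht⟩ := hb.exists_isRootReflection
    have h := hinv t v b
    rw [ht.apply_self, ht.apply_eq] at h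
    simp only [map_sub, map_neg, map_smul, LinearMap.sub_apply, LinearMap.smul_apply,
      smul_eq_mul] at h
    linarith
  have h1 := key (v := a) hb
  have h2 := key (v := b) ha
  rw [M.cartanForm_comm, hsymm b a] at h2
  have hb0 : 0 < f b b := hpos b fun h => by
    have := hb.form_self
    simp [h] at this
  have hsub : f (a - b) (a - b) = f a a + f b b - 2 * f a b := by
    simp only [map_sub, LinearMap.sub_apply, hsymm b a]
    ring
  by_cases h0 : a = b
  · subst h0
    exact ⟨ha.form_self.le, fun _ => rfl⟩
  have h3 := hpos _ (sub_ne_zero.mpr h0)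
  suffices M.cartanForm a b < 2 from ⟨this.le, fun h => absurd h this.ne⟩
  by_contra! hge
  have heq : f a a = f b b := by
    have : M.cartanForm a b ≠ 0 := by omega
    exact mul_left_cancel₀ this (h2.trans h1.symm)
  nlinarith

theorem IsRoot.form_bounds [Finite W] (ha : cs.IsRoot hM a) (hb : cs.IsRoot hM b) (h : a ≠ b)
    (h' : a ≠ -b) :
    M.cartanForm a b = -1 ∨ M.cartanForm a b = 0 ∨ M.cartanForm a b = 1 := by
  have h1 := ha.form_le_two hb
  have h2 := ha.form_le_two hb.neg
  rw [map_neg] at h2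
  have h3 : M.cartanForm a b ≠ 2 := fun e => h (h1.2 e)
  have h4 : -M.cartanForm a b ≠ 2 := fun e => h' (h2.2 e)
  omega

theorem IsRoot.ne_neg_of_nonneg (hb : cs.IsRoot hM b) (ha0 : 0 ≤ a) (hb0 : 0 ≤ b) : a ≠ -b :=
  fun h => hb.neg_nonneg_iff.mp (h ▸ ha0) hb0

/-- A reflection in a positive root `b` can only make a positive root `γ` negative if `γ = b` or
if `b - γ` is again a positive root. -/
theorem IsRoot.eq_or_form_eq_one [Finite W] (hγ : cs.IsRoot hM γ) (hγ0 : 0 ≤ γ)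
    (hb : cs.IsRootReflection hM b t) (hb0 : 0 ≤ b) (h : ¬ 0 ≤ cs.rootRep hM t γ) :
    γ = b ∨ M.cartanForm γ b = 1 := by
  by_cases hne : γ = b
  · exact Or.inl hne
  rcases hγ.form_bounds hb.isRoot hne (hb.isRoot.ne_neg_of_nonneg hγ0 hb0) with e | e | e
  · refine absurd ?_ h
    rw [hb.apply_eq, e, neg_one_smul, sub_neg_eq_add]
    exact add_nonneg hγ0 hb0
  · refine absurd ?_ h
    rwa [hb.apply_eq, e, zero_smul, sub_zero]
  · exact Or.inr e

/-! ### Inversions and length -/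

variable (cs hM) in
/-- The inversions of `w`: the positive roots that `w` makes negative. -/
def rootInversions (w : W) : Set (B →₀ ℤ) :=
  {γ | cs.IsRoot hM γ ∧ 0 ≤ γ ∧ ¬ 0 ≤ cs.rootRep hM w γ}

theorem finite_rootInversions [Finite W] (w : W) : (cs.rootInversions hM w).Finite :=
  finite_setOf_isRoot.subset fun _ h => h.1

variable (cs hM) in
/-- The root `b` is not the sum of two positive roots that `x` keeps positive. For positive roots
`b` that `x` keeps positive, this says that `x` is covered by its product with the reflection
in `b`. -/
def NoPositiveSplit (x : W) (b : B →₀ ℤ) : Prop :=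
  ∀ γ δ, cs.IsRoot hM γ → cs.IsRoot hM δ → 0 ≤ γ → 0 ≤ δ → γ + δ = b →
    0 ≤ cs.rootRep hM x γ → ¬ 0 ≤ cs.rootRep hM x δ

variable (cs hM) in
open scoped Classical in
/-- The map that applies `t` wherever the result is nonnegative and fixes all other vectors. For a
reflection `t` it is an involution on nonnegative vectors. -/
noncomputable def reflectIfNonneg (t : W) (γ : B →₀ ℤ) : B →₀ ℤ :=
  if 0 ≤ cs.rootRep hM t γ then cs.rootRep hM t γ else γ

theorem reflectIfNonneg_nonneg (hγ0 : 0 ≤ γ) :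
    0 ≤ cs.reflectIfNonneg hM t γ := by
  unfold reflectIfNonneg
  split_ifs with h
  exacts [h, hγ0]

theorem IsRootReflection.reflectIfNonneg_reflectIfNonneg (hb : cs.IsRootReflection hM b t)
    (hγ0 : 0 ≤ γ) : cs.reflectIfNonneg hM t (cs.reflectIfNonneg hM t γ) = γ := by
  unfold reflectIfNonneg
  by_cases h : 0 ≤ cs.rootRep hM t γ
  · simp [h, hb.apply_apply, hγ0]
  · simp [h]

theorem IsRoot.reflectIfNonneg (hγ : cs.IsRoot hM γ) :
    cs.IsRoot hM (cs.reflectIfNonneg hM t γ) := by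
  unfold CoxeterSystem.reflectIfNonneg
  split_ifs
  exacts [hγ.rootRep t, hγ]

/-- Let `b` be a positive root that `x` keeps positive, with reflection `t`. Then `b` and the image
of the inversions of `x` are inversions of `x * t`. -/
theorem IsRootReflection.insert_subset_rootInversions [Finite W]
    (hb : cs.IsRootReflection hM b t) (hb0 : 0 ≤ b) (hx : 0 ≤ cs.rootRep hM x b) :
    insert b (cs.reflectIfNonneg hM t '' cs.rootInversions hM x) ⊆
      cs.rootInversions hM (x * t) := by
  rintro _ (rfl | ⟨γ, ⟨hγ, hγ0, hγx⟩, rfl⟩)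
  · refine ⟨hb.isRoot, hb0, ?_⟩
    rw [rootRep_mul_apply, hb.apply_self, map_neg, (hb.isRoot.rootRep x).neg_nonneg_iff]
    exact not_not.mpr hx
  · refine ⟨hγ.reflectIfNonneg, reflectIfNonneg_nonneg hγ0, ?_⟩
    unfold reflectIfNonneg
    by_cases h : 0 ≤ cs.rootRep hM t γ
    · rwa [if_pos h, rootRep_mul_apply, hb.apply_apply]
    · rw [if_neg h]
      rcases hγ.eq_or_form_eq_one hγ0 hb hb0 h with rfl | e
      · exact absurd hx hγx
      rw [rootRep_mul_apply, ← ((hγ.rootRep t).rootRep x).neg_nonneg_iff, hb.apply_eq, e, one_smul,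
        ← map_neg, neg_sub, map_sub, sub_eq_add_neg]
      exact add_nonneg hx ((hγ.rootRep x).neg_nonneg_iff.mpr hγx)

theorem IsRootReflection.ncard_insert_rootInversions [Finite W]
    (hb : cs.IsRootReflection hM b t) (hb0 : 0 ≤ b) (hx : 0 ≤ cs.rootRep hM x b) :
    (insert b (cs.reflectIfNonneg hM t '' cs.rootInversions hM x)).ncard =
      (cs.rootInversions hM x).ncard + 1 := by
  rw [Set.ncard_insert_of_notMem _ ((finite_rootInversions x).image _), Set.InjOn.ncard_image]
  · intro γ hγ δ hδ h
    rw [← hb.reflectIfNonneg_reflectIfNonneg hγ.2.1, h, hb.reflectIfNonneg_reflectIfNonneg hδ.2.1]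
  · rintro ⟨γ, ⟨hγ, hγ0, hγx⟩, h⟩
    unfold reflectIfNonneg at h
    split_ifs at h with h'
    · have : γ = -b := by rw [← hb.apply_self, ← h, hb.apply_apply]
      exact hb.isRoot.ne_neg_of_nonneg hγ0 hb0 this
    · exact hγx (h ▸ hx)

theorem IsRootReflection.ncard_rootInversions_lt [Finite W]
    (hb : cs.IsRootReflection hM b t) (hb0 : 0 ≤ b) (hx : 0 ≤ cs.rootRep hM x b) :
    (cs.rootInversions hM x).ncard < (cs.rootInversions hM (x * t)).ncard := by
  have := Set.ncard_le_ncard (hb.insert_subset_rootInversions hb0 hx)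
    (finite_rootInversions (x * t))
  rw [hb.ncard_insert_rootInversions hb0 hx] at this
  omega

theorem IsRootReflection.ncard_rootInversions_of_noPositiveSplit [Finite W]
    (hb : cs.IsRootReflection hM b t) (hb0 : 0 ≤ b) (hx : 0 ≤ cs.rootRep hM x b)
    (hC : cs.NoPositiveSplit hM x b) :
    (cs.rootInversions hM (x * t)).ncard = (cs.rootInversions hM x).ncard + 1 := by
  rw [← hb.ncard_insert_rootInversions hb0 hx]
  congr 1
  refine (hb.insert_subset_rootInversions hb0 hx).antisymm' ?_
  rintro γ ⟨hγ, hγ0, hγx⟩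
  by_cases hγb : γ = b
  · exact Or.inl hγb
  right
  refine ⟨cs.reflectIfNonneg hM t γ, ⟨hγ.reflectIfNonneg, reflectIfNonneg_nonneg hγ0, ?_⟩,
    hb.reflectIfNonneg_reflectIfNonneg hγ0⟩
  unfold reflectIfNonneg
  rw [rootRep_mul_apply] at hγx
  by_cases h : 0 ≤ cs.rootRep hM t γ
  · rwa [if_pos h]
  · rw [if_neg h]
    have e := (hγ.eq_or_form_eq_one hγ0 hb hb0 h).resolve_left hγb
    have ht : cs.rootRep hM t γ = -(b - γ) := by rw [hb.apply_eq, e, one_smul, neg_sub]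
    have hδ : cs.IsRoot hM (b - γ) := by
      rw [← neg_neg (b - γ), ← ht]
      exact (hγ.rootRep t).neg
    rw [ht, map_neg, (hδ.rootRep x).neg_nonneg_iff, not_not] at hγx
    rw [ht, hδ.neg_nonneg_iff, not_not] at h
    exact fun hx' => hC γ (b - γ) hγ hδ hγ0 h (by abel) hx' hγx

/-- A simple root is not the sum of two positive roots. -/
theorem noPositiveSplit_single (x : W) (i : B) :
    cs.NoPositiveSplit hM x (Finsupp.single i 1) := by
  classical
  intro γ δ hγ hδ hγ0 hδ0 h
  have key {γ δ : B →₀ ℤ} (hγ : cs.IsRoot hM γ) (hγ0 : 0 ≤ γ) (hδ0 : 0 ≤ δ)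
      (h : γ + δ = Finsupp.single i 1) : 0 < γ i := by
    by_contra hi
    refine hγ.neg_nonneg_iff.mp (fun j => ?_) hγ0
    have h1 := DFunLike.congr_fun h j
    have h2 := hγ0 j
    have h3 := hδ0 j
    by_cases hj : i = j
    · subst hj
      simpa using hi
    · simp [hj] at h1 h2 h3 ⊢
      omega
  have h1 := key hγ hγ0 hδ0 h
  have h2 := key hδ hδ0 hγ0 (by rwa [add_comm])
  have h3 := DFunLike.congr_fun h i
  simp at h3
  omega

variable (cs hM) in
theorem length_eq_ncard_rootInversions [Finite W] (w : W) :
    cs.length w = (cs.rootInversions hM w).ncard := by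
  induction hn : cs.length w generalizing w with
  | zero =>
    rw [cs.length_eq_zero_iff] at hn
    subst hn
    have : cs.rootInversions hM 1 = ∅ := by
      ext γ
      simp [rootInversions]
    simp [this]
  | succ n ih =>
    obtain ⟨i, hi⟩ := cs.exists_rightDescent_of_ne_one (w := w) (by rintro rfl; simp at hn)
    rw [isRightDescent_iff] at hi
    have hs := isRootReflection_simple (cs := cs) (hM := hM) i
    have h := hs.ncard_rootInversions_of_noPositiveSplit (x := w * cs.simple i) (by simp)
      (cs.rootRep_single_nonneg hM _ i (by simp; omega))
      (noPositiveSplit_single _ i)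
    rw [simple_mul_simple_cancel_right] at h
    rw [h, ← ih _ (by omega)]

variable (cs hM) in
theorem rootRep_injective [Finite W] : Function.Injective (cs.rootRep hM) := by
  rw [injective_iff_map_eq_one]
  intro w hw
  have : cs.rootInversions hM w = ∅ := by
    ext γ
    simp [rootInversions, hw]
  rw [← cs.length_eq_zero_iff, length_eq_ncard_rootInversions cs hM, this, Set.ncard_empty]

theorem IsRootReflection.unique [Finite W] (h : cs.IsRootReflection hM b t)
    (h' : cs.IsRootReflection hM b u) : t = u :=
  rootRep_injective cs hM (LinearMap.ext fun v => by rw [h.apply_eq, h'.apply_eq])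

theorem IsRootReflection.length_lt_iff [Finite W] (hb : cs.IsRootReflection hM b t) (hb0 : 0 ≤ b) :
    cs.length x < cs.length (x * t) ↔ 0 ≤ cs.rootRep hM x b := by
  rw [length_eq_ncard_rootInversions cs hM, length_eq_ncard_rootInversions cs hM]
  refine ⟨fun h => ?_, hb.ncard_rootInversions_lt hb0⟩
  by_contra hx
  have := hb.ncard_rootInversions_lt (x := x * t) hb0 (by
    rwa [rootRep_mul_apply, hb.apply_self, map_neg, (hb.isRoot.rootRep x).neg_nonneg_iff])
  rw [mul_assoc, hb.mul_self, mul_one] at this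
  omega

/-! ### Covers in Bruhat order -/

theorem bruhatCovBy_of_length_eq (hb : cs.IsReflection t)
    (h : cs.length (x * t) = cs.length x + 1) : cs.BruhatCovBy x (x * t) := by
  let : PartialOrder W := cs.bruhatOrder
  refine ⟨lt_of_le_of_ne (Relation.ReflTransGen.single ⟨t, hb, rfl, by omega⟩) fun e => ?_, ?_⟩
  · rw [← e] at h
    omega
  · intro z hxz hzy
    have h1 := (cs.length_le_of_reflTransGen_bruhatEdge hxz.le).resolve_left hxz.ne
    have h2 := (cs.length_le_of_reflTransGen_bruhatEdge hzy.le).resolve_left hzy.ne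
    omega

theorem bruhatCovBy_of_noPositiveSplit [Finite W] (hb : cs.IsRootReflection hM b t) (hb0 : 0 ≤ b)
    (hx : 0 ≤ cs.rootRep hM x b) (hC : cs.NoPositiveSplit hM x b) :
    cs.BruhatCovBy x (x * t) := by
  refine bruhatCovBy_of_length_eq hb.isReflection ?_
  rw [length_eq_ncard_rootInversions cs hM, length_eq_ncard_rootInversions cs hM,
    hb.ncard_rootInversions_of_noPositiveSplit hb0 hx hC]

/-- A cover in Bruhat order is the multiplication by the reflection in a positive root `b` that
is kept positive and does not split: from `b = γ + δ` with both summands kept positive one would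
get the longer chain through the reflections in `γ`, `δ`, `γ`. -/
theorem BruhatCovBy.exists_isRootReflection [Finite W] {y : W} (h : cs.BruhatCovBy x y) :
    ∃ b t, cs.IsRootReflection hM b t ∧ 0 ≤ b ∧ 0 ≤ cs.rootRep hM x b ∧
      cs.NoPositiveSplit hM x b ∧ y = x * t := by
  let : PartialOrder W := cs.bruhatOrder
  have h' : x ⋖ y := h
  obtain ⟨z, ⟨t, ht, rfl, hlt⟩, hzy⟩ :=
    (Relation.ReflTransGen.cases_head h'.le).resolve_left h'.ne
  have hxz : x < x * t := lt_of_le_of_ne (Relation.ReflTransGen.single ⟨t, ht, rfl, hlt⟩)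
    fun e => by rw [← e] at hlt; exact lt_irrefl _ hlt
  have hz : x * t = y := by
    by_contra hne
    exact h'.2 hxz (lt_of_le_of_ne hzy hne)
  subst hz
  obtain ⟨b, hb0, hb⟩ := ht.exists_nonneg_isRootReflection (hM := hM)
  refine ⟨b, t, hb, hb0, (hb.length_lt_iff hb0).mp hlt, ?_, rfl⟩
  intro γ δ hγ hδ hγ0 hδ0 hsum hxγ hxδ
  obtain ⟨r, hr⟩ := hγ.exists_isRootReflection
  obtain ⟨q, hq⟩ := hδ.exists_isRootReflection
  have hform : M.cartanForm γ δ = -1 := by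
    have h2 := hb.isRoot.form_self
    rw [← hsum] at h2
    simp only [map_add, LinearMap.add_apply, hγ.form_self, hδ.form_self,
      M.cartanForm_comm δ γ] at h2
    omega
  have hrδ : cs.rootRep hM r δ = b := by
    rw [hr.apply_eq, M.cartanForm_comm, hform, ← hsum]
    module
  have hqγ : cs.rootRep hM q γ = b := by
    rw [hq.apply_eq, hform, ← hsum]
    module
  have ht' : t = r * q * r := by
    have := hq.conj r
    rw [hrδ, hr.isReflection.inv] at this
    exact hb.unique this
  have e1 : cs.length x < cs.length (x * r) := (hr.length_lt_iff hγ0).mpr hxγ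
  have e2 : cs.length (x * r) < cs.length (x * r * q) := by
    rw [hq.length_lt_iff hδ0, rootRep_mul_apply, hrδ]
    exact (hb.length_lt_iff hb0).mp hlt
  have e3 : cs.length (x * r * q) < cs.length (x * r * q * r) := by
    rw [hr.length_lt_iff hγ0, rootRep_mul_apply, rootRep_mul_apply, hqγ, ← hsum, map_add,
      hr.apply_self, hrδ, ← hsum, neg_add_cancel_left]
    exact hxδ
  have hlast : x * r * q * r = x * t := by rw [ht']; group
  have l1 : x ≤ x * r := Relation.ReflTransGen.single ⟨r, hr.isReflection, rfl, e1⟩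
  have l2 : x * r ≤ x * r * q := Relation.ReflTransGen.single ⟨q, hq.isReflection, rfl, e2⟩
  have l3 : x * r * q ≤ x * r * q * r :=
    Relation.ReflTransGen.single ⟨r, hr.isReflection, rfl, e3⟩
  refine h'.2 (c := x * r) (lt_of_le_of_ne l1 fun e => ?_) (lt_of_le_of_ne ?_ fun e => ?_)
  · rw [← e] at e1
    exact lt_irrefl _ e1
  · rw [← hlast]
    exact l2.trans l3
  · rw [← hlast] at e
    rw [← e] at e3
    omega

end CoxeterSystem

namespace CoxeterSystem

variable {B W : Type*} [Group W] {M : CoxeterMatrix B} {cs : CoxeterSystem M W}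
  {hM : M.IsSimplyLaced} {a b c d γ δ : B →₀ ℤ} {t u w x : W}

/-! ### Products of two reflections -/

/-- If the root `a` is, up to a positive factor, a combination of two roots `c`, `d` other than
`± a`, then `c`, `d` span a root system of type `A₂` and `a` is up to sign its third root. -/
theorem IsRoot.eq_or_eq_neg_of_smul_eq [Finite W] (ha : cs.IsRoot hM a) (hc : cs.IsRoot hM c)
    (hd : cs.IsRoot hM d) (hac : a ≠ c) (hac' : a ≠ -c) (had : a ≠ d) (had' : a ≠ -d)
    (hcd : c ≠ d) (hcd' : c ≠ -d) {k p q : ℤ} (hk : 0 < k) (h : k • a = p • c + q • d) :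
    a = c - M.cartanForm c d • d ∨ a = -(c - M.cartanForm c d • d) := by
  have h1 := congrArg (fun v => M.cartanForm v a) h
  have h2 := congrArg (fun v => M.cartanForm v c) h
  have h3 := congrArg (fun v => M.cartanForm v d) h
  simp only [map_add, map_smul, LinearMap.add_apply, LinearMap.smul_apply, smul_eq_mul,
    ha.form_self, hc.form_self, hd.form_self, M.cartanForm_comm c a, M.cartanForm_comm d a,
    M.cartanForm_comm d c] at h1 h2 h3
  have key (A D : ℤ) (hp : p = k * A) (hq : q = k * D) : a = A • c + D • d := by
    refine smul_right_injective _ hk.ne' ?_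
    simp only [h, hp, hq, smul_add, mul_smul]
  rcases ha.form_bounds hc hac hac' with eA | eA | eA <;>
  rcases ha.form_bounds hd had had' with eD | eD | eD <;>
  rcases hc.form_bounds hd hcd hcd' with ee | ee | ee <;>
  rw [eA, ee] at h2 <;> rw [eD, ee] at h3 <;> rw [eA, eD] at h1 <;> try omega
  all_goals
    first
    | (right; rw [key (-1) (-1) (by omega) (by omega), ee]; module)
    | (right; rw [key (-1) 1 (by omega) (by omega), ee]; module)
    | (left; rw [key 1 (-1) (by omega) (by omega), ee]; module)
    | (left; rw [key 1 1 (by omega) (by omega), ee]; module)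

/-- If `s_a s_b = s_c s_d` with `a ≠ ± b`, then `a` is a rational combination of `c` and `d`. -/
theorem IsRootReflection.exists_smul_eq [Finite W] {ta tb tc td : W}
    (ha : cs.IsRootReflection hM a ta) (hb : cs.IsRootReflection hM b tb)
    (hc : cs.IsRootReflection hM c tc) (hd : cs.IsRootReflection hM d td)
    (hab : a ≠ b) (hab' : a ≠ -b) (h : ta * tb = tc * td) :
    ∃ k p q : ℤ, 0 < k ∧ k • a = p • c + q • d := by
  -- The vector `v` is orthogonal to `b`, so `v - s_a s_b v` is a multiple of `a`.
  obtain ⟨v, hv⟩ : ∃ v, v = (2 : ℤ) • a - M.cartanForm a b • b := ⟨_, rfl⟩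
  have hvb : M.cartanForm v b = 0 := by
    simp only [hv, map_sub, map_smul, LinearMap.sub_apply, LinearMap.smul_apply, smul_eq_mul,
      hb.isRoot.form_self]
    ring
  have hva : M.cartanForm v a = 4 - M.cartanForm a b * M.cartanForm a b := by
    simp only [hv, map_sub, map_smul, LinearMap.sub_apply, LinearMap.smul_apply, smul_eq_mul,
      ha.isRoot.form_self, M.cartanForm_comm b a]
    ring
  have h1 : cs.rootRep hM (ta * tb) v = cs.rootRep hM (tc * td) v := by rw [h]
  rw [rootRep_mul_apply, rootRep_mul_apply, hb.apply_eq, hvb, zero_smul, sub_zero, ha.apply_eq,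
    hd.apply_eq, hc.apply_eq, sub_sub, sub_right_inj] at h1
  refine ⟨M.cartanForm v a, M.cartanForm (v - M.cartanForm v d • d) c, M.cartanForm v d, ?_, ?_⟩
  · rw [hva]
    rcases ha.isRoot.form_bounds hb.isRoot hab hab' with e | e | e <;> rw [e] <;> norm_num
  · rw [h1, add_comm]

/-- If `s_a s_b = s_c s_d ≠ 1` for reflections in positive roots with `a ≠ c` and `b ≠ d`, then
`b = c` or `a = d`: otherwise both `a` and `b` would be the third positive root of the system of
type `A₂` spanned by `c` and `d`. -/
theorem IsRootReflection.eq_or_eq_of_mul_eq_mul [Finite W] {ta tb tc td : W}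
    (ha : cs.IsRootReflection hM a ta) (hb : cs.IsRootReflection hM b tb)
    (hc : cs.IsRootReflection hM c tc) (hd : cs.IsRootReflection hM d td)
    (ha0 : 0 ≤ a) (hb0 : 0 ≤ b) (hc0 : 0 ≤ c) (hd0 : 0 ≤ d)
    (hab : a ≠ b) (hcd : c ≠ d) (hac : a ≠ c) (hbd : b ≠ d) (h : ta * tb = tc * td) :
    b = c ∨ a = d := by
  by_contra! hne
  obtain ⟨hbc, had⟩ := hne
  have hinv : tb * ta = td * tc := by
    have := congrArg (·⁻¹) h
    simpa [ha.isReflection.inv, hb.isReflection.inv, hc.isReflection.inv, hd.isReflection.inv]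
      using this
  obtain ⟨k, p, q, hk, e⟩ := ha.exists_smul_eq hb hc hd hab (hb.isRoot.ne_neg_of_nonneg ha0 hb0) h
  obtain ⟨k', p', q', hk', e'⟩ := hb.exists_smul_eq ha hd hc hab.symm
    (ha.isRoot.ne_neg_of_nonneg hb0 ha0) hinv
  have hcd' := hd.isRoot.ne_neg_of_nonneg hc0 hd0
  have h1 := ha.isRoot.eq_or_eq_neg_of_smul_eq hc.isRoot hd.isRoot hac
    (hc.isRoot.ne_neg_of_nonneg ha0 hc0) had (hd.isRoot.ne_neg_of_nonneg ha0 hd0) hcd hcd' hk e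
  have h2 := hb.isRoot.eq_or_eq_neg_of_smul_eq hc.isRoot hd.isRoot hbc
    (hc.isRoot.ne_neg_of_nonneg hb0 hc0) hbd (hd.isRoot.ne_neg_of_nonneg hb0 hd0) hcd hcd' hk'
    (e'.trans (add_comm _ _))
  have hab' := hb.isRoot.ne_neg_of_nonneg ha0 hb0
  rcases h1 with h1 | h1 <;> rcases h2 with h2 | h2
  · exact hab (h1.trans h2.symm)
  · exact hab' (by rw [h1, h2, neg_neg])
  · exact hab' (by rw [h1, h2])
  · exact hab (h1.trans h2.symm)

theorem IsRootReflection.eq_or_eq_neg [Finite W] (ha : cs.IsRootReflection hM a t)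
    (hb : cs.IsRootReflection hM b t) : a = b ∨ a = -b := by
  by_contra! hne
  have h := hb.apply_self
  rw [ha.apply_eq] at h
  have h' := congrArg (fun v => M.cartanForm v b) h
  simp only [map_sub, map_neg, map_smul, LinearMap.sub_apply, LinearMap.neg_apply,
    LinearMap.smul_apply, smul_eq_mul, hb.isRoot.form_self, M.cartanForm_comm b a] at h'
  rcases ha.isRoot.form_bounds hb.isRoot hne.1 hne.2 with e | e | e <;> rw [e] at h' <;> omega

/-! ### Butterflies -/

/-- Let `α`, `β` be the simple roots of a subsystem of type `A₂`, with reflections `r`, `q`. If the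
root `α + β` does not split at `x r` and `x q`, then `α` does not split at `x` and `x r q`. Indeed,
if `α = γ + δ`, then one of the summands, say `γ`, pairs to `-1` with `β` and the other to `0`, and
`α + β = (β + γ) + δ`. -/
theorem noPositiveSplit_of_add [Finite W] {α β : B →₀ ℤ} {r q : W}
    (hβ : cs.IsRootReflection hM β q) (hβ0 : 0 ≤ β)
    (hαβ : M.cartanForm α β = -1)
    (hr : cs.NoPositiveSplit hM (x * r) (α + β)) (hq : cs.NoPositiveSplit hM (x * q) (α + β)) :
    cs.NoPositiveSplit hM x α ∧ cs.NoPositiveSplit hM (x * r * q) α := by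
  have key {γ δ : B →₀ ℤ} (hγ : cs.IsRoot hM γ) (hδ : cs.IsRoot hM δ) (hγ0 : 0 ≤ γ)
      (hδ0 : 0 ≤ δ) (hsum : γ + δ = α) (eγ : M.cartanForm γ β = -1) (eδ : M.cartanForm δ β = 0) :
      (0 ≤ cs.rootRep hM x γ → ¬ 0 ≤ cs.rootRep hM x δ) ∧
        (0 ≤ cs.rootRep hM (x * r * q) γ → ¬ 0 ≤ cs.rootRep hM (x * r * q) δ) := by
    have hqγ : cs.rootRep hM q γ = γ + β := by
      rw [hβ.apply_eq, eγ]
      module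
    have hqδ : cs.rootRep hM q δ = δ := by
      rw [hβ.apply_eq, eδ]
      module
    have hroot : cs.IsRoot hM (γ + β) := hqγ ▸ hγ.rootRep q
    have hsplit : γ + β + δ = α + β := by rw [← hsum]; abel
    constructor
    · intro h1 h2
      refine hq _ _ hroot hδ (add_nonneg hγ0 hβ0) hδ0 hsplit ?_ ?_
      · rwa [rootRep_mul_apply, ← hqγ, hβ.apply_apply]
      · rwa [rootRep_mul_apply, hqδ]
    · intro h1 h2
      rw [rootRep_mul_apply, hqγ] at h1
      rw [rootRep_mul_apply, hqδ] at h2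
      exact hr _ _ hroot hδ (add_nonneg hγ0 hβ0) hδ0 hsplit h1 h2
  have cases {γ δ : B →₀ ℤ} (hγ : cs.IsRoot hM γ) (hδ : cs.IsRoot hM δ) (hγ0 : 0 ≤ γ)
      (hδ0 : 0 ≤ δ) (hsum : γ + δ = α) :
      (M.cartanForm γ β = -1 ∧ M.cartanForm δ β = 0) ∨
        (M.cartanForm δ β = -1 ∧ M.cartanForm γ β = 0) := by
    have lower {ε : B →₀ ℤ} (hε : cs.IsRoot hM ε) (hε0 : 0 ≤ ε) : -1 ≤ M.cartanForm ε β := by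
      have h := hε.form_le_two hβ.isRoot.neg
      rw [map_neg] at h
      have : -M.cartanForm ε β ≠ 2 := fun e => hβ.isRoot.ne_neg_of_nonneg hε0 hβ0 (h.2 e)
      omega
    have h1 := lower hγ hγ0
    have h2 := lower hδ hδ0
    rw [← hsum, map_add, LinearMap.add_apply] at hαβ
    omega
  constructor <;> intro γ δ hγ hδ hγ0 hδ0 hsum
  · rcases cases hγ hδ hγ0 hδ0 hsum with ⟨e1, e2⟩ | ⟨e1, e2⟩
    · exact (key hγ hδ hγ0 hδ0 hsum e1 e2).1
    · exact fun h1 h2 => (key hδ hγ hδ0 hγ0 (by rwa [add_comm]) e1 e2).1 h2 h1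
  · rcases cases hγ hδ hγ0 hδ0 hsum with ⟨e1, e2⟩ | ⟨e1, e2⟩
    · exact (key hγ hδ hγ0 hδ0 hsum e1 e2).2
    · exact fun h1 h2 => (key hδ hγ hδ0 hγ0 (by rwa [add_comm]) e1 e2).2 h2 h1

/-- The hexagon with bottom `x`: if `x` keeps the simple roots `α`, `β` of a subsystem of type `A₂`
positive and `α + β` does not split at `x s_α` and `x s_β`, then `x` is covered by `x s_α` and
`x s_β`, and `x s_α s_β`, `x s_β s_α` are covered by `x s_α s_β s_α = x s_β s_α s_β`. -/
theorem bruhatCovBy_hexagon [Finite W] {α β : B →₀ ℤ} {r q : W}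
    (hα : cs.IsRootReflection hM α r) (hβ : cs.IsRootReflection hM β q) (hα0 : 0 ≤ α)
    (hβ0 : 0 ≤ β) (hαβ : M.cartanForm α β = -1) (hxα : 0 ≤ cs.rootRep hM x α)
    (hxβ : 0 ≤ cs.rootRep hM x β)
    (hr : cs.NoPositiveSplit hM (x * r) (α + β)) (hq : cs.NoPositiveSplit hM (x * q) (α + β)) :
    (cs.BruhatCovBy x (x * r) ∧ cs.BruhatCovBy x (x * q)) ∧
      cs.BruhatCovBy (x * r * q) (x * r * q * r) ∧
      cs.BruhatCovBy (x * q * r) (x * q * r * q) := by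
  have hβα : M.cartanForm β α = -1 := by rw [M.cartanForm_comm, hαβ]
  obtain ⟨h1, h2⟩ := noPositiveSplit_of_add hβ hβ0 hαβ hr hq
  obtain ⟨h3, h4⟩ := noPositiveSplit_of_add hα hα0 hβα (add_comm α β ▸ hq) (add_comm α β ▸ hr)
  refine ⟨⟨bruhatCovBy_of_noPositiveSplit hα hα0 hxα h1,
    bruhatCovBy_of_noPositiveSplit hβ hβ0 hxβ h3⟩,
    bruhatCovBy_of_noPositiveSplit hα hα0 ?_ h2, bruhatCovBy_of_noPositiveSplit hβ hβ0 ?_ h4⟩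
  · convert hxβ using 1
    rw [rootRep_mul_apply, rootRep_mul_apply, hβ.apply_eq, hαβ, neg_one_smul, sub_neg_eq_add,
      map_add, hα.apply_self, hα.apply_eq, hβα]
    congr 1
    module
  · convert hxα using 1
    rw [rootRep_mul_apply, rootRep_mul_apply, hα.apply_eq, hβα, neg_one_smul, sub_neg_eq_add,
      map_add, hβ.apply_self, hβ.apply_eq, hαβ]
    congr 1
    module

/-- A butterfly `x₁ = x`, `x₂ = x s_a s_c`, `y₁ = x s_a`, `y₂ = x s_c` with `s_a s_c = s_c s_d`
consists of the two middle levels of a hexagon with bottom `x s_d`. The signs of the roots at `x₁`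
and `x₂` force `c = a + d`. -/
theorem exists_bruhatCovBy_of_mul_eq_mul [Finite W] {ta tc td : W}
    (ha : cs.IsRootReflection hM a ta) (hc : cs.IsRootReflection hM c tc)
    (hd : cs.IsRootReflection hM d td) (ha0 : 0 ≤ a) (hc0 : 0 ≤ c) (hd0 : 0 ≤ d)
    (hac : a ≠ c) (h : ta * tc = tc * td)
    (hxa : 0 ≤ cs.rootRep hM x a) (hxc : 0 ≤ cs.rootRep hM x c)
    (hxc' : 0 ≤ cs.rootRep hM (x * ta * tc) c) (hxd' : 0 ≤ cs.rootRep hM (x * ta * tc) d)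
    (h₁ : cs.NoPositiveSplit hM x c) (h₂ : cs.NoPositiveSplit hM (x * ta * tc) c) :
    (∃ u, cs.BruhatCovBy u x ∧ cs.BruhatCovBy u (x * ta * tc)) ∧
      ∃ z, cs.BruhatCovBy (x * ta) z ∧ cs.BruhatCovBy (x * tc) z := by
  have hd_conj : tc * ta * tc⁻¹ = td := by
    rw [hc.isReflection.inv, mul_assoc, h, ← mul_assoc, hc.mul_self, one_mul]
  have hxca : ¬ 0 ≤ cs.rootRep hM x (cs.rootRep hM ta c) := by
    rw [rootRep_mul_apply, hc.apply_self, map_neg, rootRep_mul_apply,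
      ((hc.isRoot.rootRep ta).rootRep x).neg_nonneg_iff] at hxc'
    exact hxc'
  have hac1 : M.cartanForm a c = 1 := by
    rw [ha.apply_eq, M.cartanForm_comm] at hxca
    rcases ha.isRoot.form_bounds hc.isRoot hac (hc.isRoot.ne_neg_of_nonneg ha0 hc0) with e | e | e
    · refine absurd ?_ hxca
      rw [e, neg_one_smul, sub_neg_eq_add, map_add]
      exact add_nonneg hxc hxa
    · refine absurd ?_ hxca
      rwa [e, zero_smul, sub_zero]
    · exact e
  have hca : cs.rootRep hM tc a = a - c := by rw [hc.apply_eq, hac1, one_smul]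
  have hd_eq : d = c - a := by
    have := ha.conj tc
    rw [hca, hd_conj] at this
    rcases hd.eq_or_eq_neg this with e | e
    · exfalso
      have hd1 : cs.rootRep hM tc d = a := by rw [e, ← hca, hc.apply_apply]
      rw [mul_assoc, h, ← mul_assoc, rootRep_mul_apply, hd.apply_self, map_neg, rootRep_mul_apply,
        hd1, (ha.isRoot.rootRep x).neg_nonneg_iff] at hxd'
      exact hxd' hxa
    · rw [e, neg_sub]
  have hsum : d + a = c := by rw [hd_eq]; abel
  have hda : M.cartanForm d a = -1 := by
    rw [hd_eq, map_sub, LinearMap.sub_apply, M.cartanForm_comm c a, hac1, ha.isRoot.form_self]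
    norm_num
  have hdda : cs.rootRep hM td a = c := by
    rw [hd.apply_eq, M.cartanForm_comm, hda, ← hsum]
    module
  have haad : cs.rootRep hM ta d = c := by
    rw [ha.apply_eq, hda, ← hsum]
    module
  have e1 : td * ta * td = tc := by
    have := ha.conj td
    rw [hdda, hd.isReflection.inv] at this
    exact this.unique hc
  have e2 : ta * td * ta = tc := by
    have := hd.conj ta
    rw [haad, ha.isReflection.inv] at this
    exact this.unique hc
  have hx1 : x * td * td = x := by rw [mul_assoc, hd.mul_self, mul_one]
  have hx2 : x * td * ta = x * ta * tc := by
    rw [mul_assoc x ta, h, ← e1]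
    simp only [mul_assoc, hd.mul_self, mul_one]
  have hy2 : x * td * ta * td = x * tc := by rw [← e1]; group
  have hz : x * tc * ta = x * ta * td := by
    rw [← e2]
    simp only [mul_assoc, ha.mul_self, mul_one]
  have hxd : 0 ≤ cs.rootRep hM (x * td) d := by
    rw [rootRep_mul_apply, hd.apply_self, map_neg, (hd.isRoot.rootRep x).neg_nonneg_iff, hd_eq]
    rwa [ha.apply_eq, M.cartanForm_comm, hac1, one_smul] at hxca
  obtain ⟨⟨c1, c2⟩, c3, c4⟩ := bruhatCovBy_hexagon (x := x * td) hd ha hd0 ha0 hda hxd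
    (by rwa [rootRep_mul_apply, hdda])
    (by rwa [hx1, hsum]) (by rwa [hx2, hsum])
  rw [hx1] at c1 c3
  rw [hx2] at c2
  rw [hy2, hz] at c4
  refine ⟨⟨x * td, c1, c2⟩, x * ta * td, c3, c4⟩

end CoxeterSystem

theorem lemma7p2 {B W : Type*} [Group W] [Finite W] {M : CoxeterMatrix B}
    (cs : CoxeterSystem M W) (hM : M.IsSimplyLaced) (x₁ x₂ y₁ y₂ : W)
    (h : cs.IsButterfly x₁ x₂ y₁ y₂) :
    (∃ u : W, cs.BruhatCovBy u x₁ ∧ cs.BruhatCovBy u x₂) ∧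
      ∃ z : W, cs.BruhatCovBy y₁ z ∧ cs.BruhatCovBy y₂ z := by
  obtain ⟨hx, hy, h₁₁, h₁₂, h₂₁, h₂₂⟩ := h
  obtain ⟨a, ta, ha, ha0, hxa, hCa, rfl⟩ := h₁₁.exists_isRootReflection (hM := hM)
  obtain ⟨c, tc, hc, hc0, hxc, hCc, rfl⟩ := h₁₂.exists_isRootReflection (hM := hM)
  obtain ⟨b, tb, hb, hb0, hxb, hCb, hy₁⟩ := h₂₁.exists_isRootReflection (hM := hM)
  obtain ⟨d, td, hd, hd0, hxd, hCd, hy₂⟩ := h₂₂.exists_isRootReflection (hM := hM)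
  have hx₂ : x₂ = x₁ * ta * tb := by rw [hy₁, mul_assoc, hb.mul_self, mul_one]
  have hx₂' : x₂ = x₁ * tc * td := by rw [hy₂, mul_assoc, hd.mul_self, mul_one]
  -- Both products are equal to `x₁⁻¹ x₂`.
  have hmul : ta * tb = tc * td := by
    apply mul_left_cancel (a := x₁)
    rw [← mul_assoc, ← mul_assoc, ← hx₂, ← hx₂']
  have hac : a ≠ c := fun e => hy (by subst e; rw [ha.unique hc])
  have hbd : b ≠ d := fun e => hy (by subst e; rw [hy₁, hy₂, hb.unique hd])
  have hab : a ≠ b := fun e => hx (by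
    subst e
    rw [hx₂, ha.unique hb, mul_assoc, hb.mul_self, mul_one])
  have hcd : c ≠ d := fun e => hx (by
    subst e
    rw [hx₂', hc.unique hd, mul_assoc, hd.mul_self, mul_one])
  rcases ha.eq_or_eq_of_mul_eq_mul hb hc hd ha0 hb0 hc0 hd0 hab hcd hac hbd hmul with e | e
  · subst e
    obtain rfl := hb.unique hc
    subst hx₂
    exact CoxeterSystem.exists_bruhatCovBy_of_mul_eq_mul ha hb hd ha0 hb0 hd0 hac hmul hxa hxc hxb
      hxd hCc hCb
  -- The case `a = d` becomes the case `b = c` when `y₁` and `y₂` are exchanged.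
  · subst e
    obtain rfl := ha.unique hd
    subst hx₂'
    obtain ⟨hu, z, hz₁, hz₂⟩ := CoxeterSystem.exists_bruhatCovBy_of_mul_eq_mul hc ha hb hc0 ha0 hb0
      hac.symm hmul.symm hxc hxa hxd hxb hCa hCd
    exact ⟨hu, z, hz₂, hz₁⟩
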